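/- Let $W(\mathbf{Q})$ be the Witt group of nonsingular symmetric bilinear forms over $\mathbf{Q}$ (that is, of nonsingular symmetric rational matrices, up to isometry after adding metabolic forms, with orthogonal direct sum as addition). For $w \in W(\mathbf{Q})$ let $\rho(w)$ be the Witt rank of $w$, i.e. the minimal dimension of a nonsingular symmetric rational matrix representing $w$, and let $\sigma(w) \in \mathbf{Z}$ be the signature of $w$. Then for every $w \in W(\mathbf{Q})$, $$\rho(4w) = 4\,|\sigma(w)|.$$ -/

import Mathlib

/-- A nonsingular hermitian matrix of finite size over a field `F` with (possibly trivial)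
involution `star`; this is a nonsingular hermitian form on `F ^ dim`. -/
structure HermitianForm (F : Type*) [Field F] [StarRing F] where
  /-- The dimension (rank) of the form. -/
  dim : ℕ
  /-- The matrix of the form. -/
  matrix : Matrix (Fin dim) (Fin dim) F
  isHermitian : matrix.IsHermitian
  isUnit_det : IsUnit matrix.det

namespace HermitianForm

section General

variable {F : Type*} [Field F] [StarRing F]

/-- The sesquilinear pairing `(x, y) ↦ x* A y`. -/
def pairing (A : HermitianForm F) (x y : Fin A.dim → F) : F :=
  dotProduct (star x) (A.matrix.mulVec y)

/-- Two forms are isometric if a linear isomorphism carries one pairing to the other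
(equivalently, the matrices are congruent). -/
def Isometric (A B : HermitianForm F) : Prop :=
  ∃ e : (Fin A.dim → F) ≃ₗ[F] (Fin B.dim → F),
    ∀ x y, B.pairing (e x) (e y) = A.pairing x y

/-- A form is metabolic if it vanishes identically on a subspace of half the dimension. -/
def IsMetabolic (A : HermitianForm F) : Prop :=
  ∃ N : Submodule F (Fin A.dim → F),
    2 * Module.finrank F N = A.dim ∧ ∀ x ∈ N, ∀ y ∈ N, A.pairing x y = 0

/-- The form of dimension zero. -/
def zeroForm (F : Type*) [Field F] [StarRing F] : HermitianForm F where
  dim := 0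
  matrix := 0
  isHermitian := Matrix.isHermitian_zero
  isUnit_det := by simp

/-- The form with the negated matrix. -/
def neg (A : HermitianForm F) : HermitianForm F where
  dim := A.dim
  matrix := -A.matrix
  isHermitian := A.isHermitian.neg
  isUnit_det := by
    rw [Matrix.det_neg]
    exact ((isUnit_one.neg).pow _).mul A.isUnit_det

/-- The orthogonal direct sum, given by the block diagonal matrix. -/
def sum (A B : HermitianForm F) : HermitianForm F where
  dim := A.dim + B.dim
  matrix := Matrix.reindex finSumFinEquiv finSumFinEquiv
    (Matrix.fromBlocks A.matrix 0 0 B.matrix)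
  isHermitian := by
    rw [Matrix.reindex_apply]
    refine Matrix.IsHermitian.submatrix ?_ _
    exact Matrix.IsHermitian.fromBlocks A.isHermitian (by simp) B.isHermitian
  isUnit_det := by
    rw [Matrix.det_reindex_self, Matrix.det_fromBlocks_zero₂₁]
    exact A.isUnit_det.mul B.isUnit_det

/-- The identification of the underlying space of a direct sum with the product. -/
def sumEquiv (A B : HermitianForm F) :
    (Fin (A.sum B).dim → F) ≃ₗ[F] (Fin A.dim → F) × (Fin B.dim → F) :=
  (LinearEquiv.funCongrLeft F F finSumFinEquiv).trans
    (LinearEquiv.sumArrowLequivProdArrow (Fin A.dim) (Fin B.dim) F F)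

theorem pairing_sum (A B : HermitianForm F) (x y : Fin (A.sum B).dim → F) :
    (A.sum B).pairing x y = A.pairing (A.sumEquiv B x).1 (A.sumEquiv B y).1 +
      B.pairing (A.sumEquiv B x).2 (A.sumEquiv B y).2 := by
  have h : ∀ u v : Fin (A.dim + B.dim) → F,
      dotProduct (star u) ((Matrix.reindex finSumFinEquiv finSumFinEquiv
        (Matrix.fromBlocks A.matrix 0 0 B.matrix)).mulVec v) =
      dotProduct (star (fun i => u (finSumFinEquiv (Sum.inl i))))
        (A.matrix.mulVec (fun i => v (finSumFinEquiv (Sum.inl i)))) +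
      dotProduct (star (fun i => u (finSumFinEquiv (Sum.inr i))))
        (B.matrix.mulVec (fun i => v (finSumFinEquiv (Sum.inr i)))) := by
    intro u v
    rw [Matrix.reindex_apply, Matrix.submatrix_mulVec_equiv, Equiv.symm_symm,
      Matrix.fromBlocks_mulVec]
    simp only [dotProduct]
    rw [← finSumFinEquiv.sum_comp, Fintype.sum_sum_type]
    simp [Function.comp_def]
  exact h x y

theorem pairing_sum_symm (A B : HermitianForm F) (p q : (Fin A.dim → F) × (Fin B.dim → F)) :
    (A.sum B).pairing ((A.sumEquiv B).symm p) ((A.sumEquiv B).symm q) =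
      A.pairing p.1 q.1 + B.pairing p.2 q.2 := by
  rw [pairing_sum]; simp

theorem pairing_neg (A : HermitianForm F) (x y : Fin A.dim → F) :
    A.neg.pairing x y = -A.pairing x y := by
  have h : ∀ u v : Fin A.dim → F, dotProduct (star u) ((-A.matrix).mulVec v) =
      -dotProduct (star u) (A.matrix.mulVec v) := fun u v => by
    rw [Matrix.neg_mulVec, dotProduct_neg]
  exact h x y

theorem pairing_zeroForm (x y : Fin (zeroForm F).dim → F) : (zeroForm F).pairing x y = 0 := by
  have h : ∀ u v : Fin 0 → F, dotProduct (star u) ((0 : Matrix (Fin 0) (Fin 0) F).mulVec v) = 0 :=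
    fun u v => by simp
  exact h x y

theorem Isometric.refl (A : HermitianForm F) : A.Isometric A :=
  ⟨LinearEquiv.refl F _, fun _ _ => rfl⟩

theorem Isometric.symm {A B : HermitianForm F} (h : A.Isometric B) : B.Isometric A := by
  obtain ⟨e, he⟩ := h
  exact ⟨e.symm, fun x y => by rw [← he]; simp⟩

theorem Isometric.trans {A B C : HermitianForm F} (h : A.Isometric B) (h' : B.Isometric C) :
    A.Isometric C := by
  obtain ⟨e, he⟩ := h
  obtain ⟨f, hf⟩ := h'
  exact ⟨e.trans f, fun x y => by simp [hf, he]⟩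

theorem Isometric.sum {A B C D : HermitianForm F} (h : A.Isometric B) (h' : C.Isometric D) :
    (A.sum C).Isometric (B.sum D) := by
  obtain ⟨e, he⟩ := h
  obtain ⟨f, hf⟩ := h'
  refine ⟨(A.sumEquiv C).trans ((LinearEquiv.prodCongr e f).trans (B.sumEquiv D).symm),
    fun x y => ?_⟩
  simp only [LinearEquiv.trans_apply]
  rw [pairing_sum_symm, pairing_sum]
  simp [he, hf]

theorem sum_comm (A B : HermitianForm F) : (A.sum B).Isometric (B.sum A) := by
  refine ⟨(A.sumEquiv B).trans ((LinearEquiv.prodComm F _ _).trans (B.sumEquiv A).symm),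
    fun x y => ?_⟩
  simp only [LinearEquiv.trans_apply]
  rw [pairing_sum_symm, pairing_sum]
  simp [add_comm]

theorem sum_assoc (A B C : HermitianForm F) :
    ((A.sum B).sum C).Isometric (A.sum (B.sum C)) := by
  refine ⟨((A.sum B).sumEquiv C).trans
    ((LinearEquiv.prodCongr (A.sumEquiv B) (LinearEquiv.refl F _)).trans
    ((LinearEquiv.prodAssoc F _ _ _).trans
    ((LinearEquiv.prodCongr (LinearEquiv.refl F _) (B.sumEquiv C).symm).trans
      (A.sumEquiv (B.sum C)).symm))), fun x y => ?_⟩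
  simp only [LinearEquiv.trans_apply]
  rw [pairing_sum_symm, pairing_sum (A.sum B) C, pairing_sum A B]
  simp [pairing_sum_symm, add_assoc]

theorem zero_sum (A : HermitianForm F) : ((zeroForm F).sum A).Isometric A := by
  have : Subsingleton (Fin (zeroForm F).dim → F) := ⟨fun f g => funext fun i => Fin.elim0 i⟩
  have : Unique (Fin (zeroForm F).dim → F) := ⟨⟨0⟩, fun _ => Subsingleton.elim _ _⟩
  refine ⟨((zeroForm F).sumEquiv A).trans (LinearEquiv.uniqueProd), fun x y => ?_⟩
  rw [pairing_sum, pairing_zeroForm, zero_add]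
  rfl

theorem sum_sum_sum_comm (A B C D : HermitianForm F) :
    ((A.sum B).sum (C.sum D)).Isometric ((A.sum C).sum (B.sum D)) := by
  refine (sum_assoc A B (C.sum D)).trans (((Isometric.refl A).sum ?_).trans
    (sum_assoc A C (B.sum D)).symm)
  exact (sum_assoc B C D).symm.trans
    (((sum_comm B C).sum (Isometric.refl D)).trans (sum_assoc C B D))

theorem IsMetabolic.sum {A B : HermitianForm F} (hA : A.IsMetabolic) (hB : B.IsMetabolic) :
    (A.sum B).IsMetabolic := by
  obtain ⟨M, hM, hM'⟩ := hA
  obtain ⟨N, hN, hN'⟩ := hB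
  let f : (M × N) →ₗ[F] (Fin (A.sum B).dim → F) :=
    (A.sumEquiv B).symm.toLinearMap ∘ₗ (LinearMap.prodMap M.subtype N.subtype)
  have hf : Function.Injective f :=
    (A.sumEquiv B).symm.injective.comp
      (Function.Injective.prodMap M.injective_subtype N.injective_subtype)
  refine ⟨LinearMap.range f, ?_, ?_⟩
  · rw [LinearMap.finrank_range_of_inj hf, Module.finrank_prod, mul_add, hM, hN]
    rfl
  · rintro _ ⟨p, rfl⟩ _ ⟨q, rfl⟩
    have := pairing_sum_symm A B (p.1, p.2) (q.1, q.2)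
    rw [hM' _ p.1.2 _ q.1.2, hN' _ p.2.2 _ q.2.2, add_zero] at this
    exact this

theorem isMetabolic_zeroForm : (zeroForm F).IsMetabolic := by
  refine ⟨⊥, ?_, fun _ _ _ _ => pairing_zeroForm _ _⟩
  rw [finrank_bot]
  rfl

theorem isMetabolic_neg_sum (A : HermitianForm F) : (A.neg.sum A).IsMetabolic := by
  let f : (Fin A.dim → F) →ₗ[F] (Fin (A.neg.sum A).dim → F) :=
    (A.neg.sumEquiv A).symm.toLinearMap ∘ₗ (LinearMap.prod LinearMap.id LinearMap.id)
  have hf : Function.Injective f := by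
    refine (A.neg.sumEquiv A).symm.injective.comp fun x y h => ?_
    exact congrArg Prod.fst h
  refine ⟨LinearMap.range f, ?_, ?_⟩
  · rw [LinearMap.finrank_range_of_inj hf, Module.finrank_fin_fun, two_mul]
    rfl
  · rintro _ ⟨x, rfl⟩ _ ⟨y, rfl⟩
    have := pairing_sum_symm A.neg A (x, x) (y, y)
    rw [pairing_neg, neg_add_cancel] at this
    exact this

/-- Witt equivalence: the forms become isometric after adding metabolic forms. -/
def WittEquiv (A B : HermitianForm F) : Prop :=
  ∃ M N : HermitianForm F, M.IsMetabolic ∧ N.IsMetabolic ∧ (A.sum M).Isometric (B.sum N)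

theorem Isometric.wittEquiv {A B : HermitianForm F} (h : A.Isometric B) : A.WittEquiv B :=
  ⟨zeroForm F, zeroForm F, isMetabolic_zeroForm, isMetabolic_zeroForm,
    h.sum (Isometric.refl _)⟩

theorem WittEquiv.symm {A B : HermitianForm F} (h : A.WittEquiv B) : B.WittEquiv A := by
  obtain ⟨M, N, hM, hN, h⟩ := h
  exact ⟨N, M, hN, hM, h.symm⟩

theorem WittEquiv.trans {A B C : HermitianForm F} (h : A.WittEquiv B) (h' : B.WittEquiv C) :
    A.WittEquiv C := by
  obtain ⟨M, N, hM, hN, h⟩ := h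
  obtain ⟨M', N', hM', hN', h'⟩ := h'
  refine ⟨M.sum M', N'.sum N, hM.sum hM', hN'.sum hN, ?_⟩
  refine (sum_assoc A M M').symm.trans ((h.sum (Isometric.refl M')).trans ?_)
  refine (sum_assoc B N M').trans (((Isometric.refl B).sum (sum_comm N M')).trans ?_)
  exact (sum_assoc B M' N).symm.trans
    ((h'.sum (Isometric.refl N)).trans (sum_assoc C N' N))

theorem WittEquiv.sum {A B C D : HermitianForm F} (h : A.WittEquiv B) (h' : C.WittEquiv D) :
    (A.sum C).WittEquiv (B.sum D) := by
  obtain ⟨M, N, hM, hN, h⟩ := h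
  obtain ⟨M', N', hM', hN', h'⟩ := h'
  exact ⟨M.sum M', N.sum N', hM.sum hM', hN.sum hN',
    (sum_sum_sum_comm A C M M').trans ((h.sum h').trans (sum_sum_sum_comm B N D N'))⟩

theorem IsMetabolic.wittEquiv_zero {A : HermitianForm F} (h : A.IsMetabolic) :
    A.WittEquiv (zeroForm F) :=
  ⟨zeroForm F, A, isMetabolic_zeroForm, h, sum_comm A (zeroForm F)⟩

theorem WittEquiv.neg {A B : HermitianForm F} (h : A.WittEquiv B) : A.neg.WittEquiv B.neg := by
  have h0 : ∀ C : HermitianForm F, C.WittEquiv ((zeroForm F).sum C) := fun C =>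
    (zero_sum C).symm.wittEquiv
  have hr : ∀ C : HermitianForm F, C.WittEquiv C := fun C => (Isometric.refl C).wittEquiv
  have h1 := (h0 A.neg).trans ((isMetabolic_neg_sum B).wittEquiv_zero.symm.sum (hr A.neg))
  have h2 := ((hr B.neg).sum h.symm).sum (hr A.neg)
  have h3 := (sum_assoc B.neg A A.neg).wittEquiv.trans
    ((hr B.neg).sum ((sum_comm A A.neg).wittEquiv.trans (isMetabolic_neg_sum A).wittEquiv_zero))
  exact h1.trans (h2.trans (h3.trans ((sum_comm B.neg (zeroForm F)).wittEquiv.trans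
    (h0 B.neg).symm)))

/-- Witt equivalence as a setoid. -/
instance wittSetoid (F : Type*) [Field F] [StarRing F] : Setoid (HermitianForm F) where
  r := WittEquiv
  iseqv := ⟨fun A => (Isometric.refl A).wittEquiv, WittEquiv.symm, WittEquiv.trans⟩

end General

end HermitianForm

/-- The Witt group `W(F)` of nonsingular hermitian forms over a field `F` with involution. -/
def WittGroup (F : Type*) [Field F] [StarRing F] : Type _ :=
  Quotient (HermitianForm.wittSetoid F)

namespace WittGroup

section General

variable {F : Type*} [Field F] [StarRing F]

/-- The Witt class of a form. -/
def mk (A : HermitianForm F) : WittGroup F := Quotient.mk (HermitianForm.wittSetoid F) A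

theorem mk_eq_of_isometric {A B : HermitianForm F} (h : A.Isometric B) : mk A = mk B :=
  Quotient.sound h.wittEquiv

/-- Addition is orthogonal direct sum. -/
instance : Add (WittGroup F) :=
  ⟨Quotient.map₂ HermitianForm.sum fun _ _ h _ _ h' => HermitianForm.WittEquiv.sum h h'⟩

/-- Zero is the class of the form of dimension zero. -/
instance : Zero (WittGroup F) := ⟨mk (HermitianForm.zeroForm F)⟩

/-- The inverse is given by negating the matrix. -/
instance : Neg (WittGroup F) :=
  ⟨Quotient.map HermitianForm.neg fun _ _ h => HermitianForm.WittEquiv.neg h⟩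

instance : AddCommGroup (WittGroup F) where
  add_assoc := by
    rintro ⟨A⟩ ⟨B⟩ ⟨C⟩
    exact mk_eq_of_isometric (HermitianForm.sum_assoc A B C)
  zero_add := by
    rintro ⟨A⟩
    exact mk_eq_of_isometric (HermitianForm.zero_sum A)
  add_zero := by
    rintro ⟨A⟩
    exact mk_eq_of_isometric ((HermitianForm.sum_comm A _).trans (HermitianForm.zero_sum A))
  add_comm := by
    rintro ⟨A⟩ ⟨B⟩
    exact mk_eq_of_isometric (HermitianForm.sum_comm A B)
  neg_add_cancel := by
    rintro ⟨A⟩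
    exact Quotient.sound (HermitianForm.isMetabolic_neg_sum A).wittEquiv_zero
  nsmul := nsmulRec
  zsmul := zsmulRec

theorem mk_sum (A B : HermitianForm F) : mk (A.sum B) = mk A + mk B := rfl

/-- The Witt rank `ρ(w)`: the minimal dimension of a nonsingular hermitian matrix representing
the class `w`. -/
noncomputable def rank (w : WittGroup F) : ℕ :=
  sInf {n : ℕ | ∃ A : HermitianForm F, mk A = w ∧ A.dim = n}

/-- The minimum is attained. -/
theorem exists_dim_eq_rank (w : WittGroup F) :
    ∃ A : HermitianForm F, mk A = w ∧ A.dim = w.rank := by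
  refine Nat.sInf_mem (s := {n : ℕ | ∃ A : HermitianForm F, mk A = w ∧ A.dim = n}) ?_
  obtain ⟨A, hA⟩ := Quotient.exists_rep w
  exact ⟨A.dim, A, hA, rfl⟩

end General

end WittGroup

namespace HermitianForm

/-- The rational quadratic form `x ↦ xᵗ A x` of a nonsingular symmetric rational matrix
(the involution on `ℚ` is the identity). -/
def quadraticForm (A : HermitianForm ℚ) : QuadraticForm ℚ (Fin A.dim → ℚ) :=
  A.matrix.toQuadraticForm'

theorem quadraticForm_apply (A : HermitianForm ℚ) (x : Fin A.dim → ℚ) :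
    A.quadraticForm x = A.pairing x x := by
  simp [quadraticForm, pairing, Matrix.toQuadraticForm', Matrix.toLinearMap₂'_apply']

/-- The signature: the maximal dimension of a positive definite subspace minus the maximal
dimension of a negative definite subspace. -/
noncomputable def signature (A : HermitianForm ℚ) : ℤ :=
  (sigPos A.quadraticForm : ℤ) - (sigNeg A.quadraticForm : ℤ)

theorem Isometric.equivalent {A B : HermitianForm ℚ} (h : A.Isometric B) :
    A.quadraticForm.Equivalent B.quadraticForm := by
  obtain ⟨e, he⟩ := h
  exact ⟨⟨e, fun x => by
    have := he x x
    rw [← quadraticForm_apply, ← quadraticForm_apply] at this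
    exact this⟩⟩

theorem Isometric.signature_eq {A B : HermitianForm ℚ} (h : A.Isometric B) :
    A.signature = B.signature := by
  rw [signature, signature, h.equivalent.sigPos_eq, h.equivalent.sigNeg_eq]

theorem eq_zero_of_pairing (A : HermitianForm ℚ) (x : Fin A.dim → ℚ)
    (h : ∀ y, A.pairing y x = 0) : x = 0 := by
  have h1 : A.matrix.mulVec x = 0 := by
    refine dotProduct_eq_zero _ fun y => ?_
    rw [dotProduct_comm]
    have := h y
    rwa [pairing, star_trivial] at this
  have h2 : A.matrix⁻¹.mulVec (A.matrix.mulVec x) = x := by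
    rw [Matrix.mulVec_mulVec, Matrix.nonsing_inv_mul _ A.isUnit_det, Matrix.one_mulVec]
  rw [← h2, h1, Matrix.mulVec_zero]

theorem pairing_comm (A : HermitianForm ℚ) (x y : Fin A.dim → ℚ) :
    A.pairing x y = A.pairing y x := by
  have hA : A.matrix.transpose = A.matrix := by
    have := A.isHermitian
    rwa [Matrix.IsHermitian, Matrix.conjTranspose_eq_transpose_of_trivial] at this
  rw [pairing, pairing, star_trivial, star_trivial, Matrix.dotProduct_mulVec,
    ← Matrix.mulVec_transpose, hA, dotProduct_comm]

theorem pairing_add_add (A : HermitianForm ℚ) (x y : Fin A.dim → ℚ) :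
    A.pairing (x + y) (x + y) =
      A.pairing x x + A.pairing y y + (A.pairing x y + A.pairing y x) := by
  simp only [pairing, star_trivial, Matrix.mulVec_add, dotProduct_add, add_dotProduct]
  ring

theorem sigPos_add_sigNeg (A : HermitianForm ℚ) :
    sigPos A.quadraticForm + sigNeg A.quadraticForm = A.dim := by
  have h := QuadraticForm.sigPos_add_sigNeg_add_radical (Q := A.quadraticForm)
  have hr : A.quadraticForm.radical = ⊥ := by
    rw [Submodule.eq_bot_iff]
    intro x hx
    rw [QuadraticMap.mem_radical_iff'] at hx
    refine A.eq_zero_of_pairing x fun y => ?_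
    have h1 := hx.1
    have h2 := hx.2 y
    rw [quadraticForm_apply] at h1
    rw [quadraticForm_apply, quadraticForm_apply, pairing_add_add, A.pairing_comm x y] at h2
    linarith
  rw [hr, finrank_bot, Module.finrank_fin_fun] at h
  exact h

theorem IsMetabolic.signature_eq_zero {A : HermitianForm ℚ} (h : A.IsMetabolic) :
    A.signature = 0 := by
  obtain ⟨N, hN, hN'⟩ := h
  have h0 : ∀ x ∈ N, A.quadraticForm x = 0 := fun x hx => by
    rw [quadraticForm_apply]
    exact hN' x hx x hx
  have h1 := QuadraticForm.sigPos_add_finrank_le_of_nonpos (Q := A.quadraticForm) (V := N)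
    fun x hx => (h0 x hx).le
  have h2 := QuadraticForm.sigPos_add_finrank_le_of_nonpos (Q := -A.quadraticForm) (V := N)
    fun x hx => by rw [_root_.neg_apply, h0 x hx, neg_zero]
  have h3 := A.sigPos_add_sigNeg
  rw [Module.finrank_fin_fun] at h1 h2
  rw [sigPos_neg] at h2
  rw [signature]
  omega

theorem quadraticForm_sum_equivalent (A B : HermitianForm ℚ) :
    (A.quadraticForm.prod B.quadraticForm).Equivalent (A.sum B).quadraticForm :=
  ⟨⟨(A.sumEquiv B).symm, fun p => by
    have := pairing_sum_symm A B p p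
    rw [← quadraticForm_apply, ← quadraticForm_apply, ← quadraticForm_apply] at this
    exact this⟩⟩

theorem sigPos_add_le_prod {V W : Type*} [AddCommGroup V] [Module ℚ V] [FiniteDimensional ℚ V]
    [AddCommGroup W] [Module ℚ W] [FiniteDimensional ℚ W]
    (P : QuadraticForm ℚ V) (Q : QuadraticForm ℚ W) :
    sigPos P + sigPos Q ≤ sigPos (QuadraticMap.prod P Q) := by
  obtain ⟨M, hM, hM'⟩ := exists_finrank_eq_sigPos_and_posDef P
  obtain ⟨N, hN, hN'⟩ := exists_finrank_eq_sigPos_and_posDef Q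
  let f : (M × N) →ₗ[ℚ] V × W := LinearMap.prodMap M.subtype N.subtype
  have hf : Function.Injective f :=
    Function.Injective.prodMap M.injective_subtype N.injective_subtype
  rw [← hM, ← hN, ← Module.finrank_prod, ← LinearMap.finrank_range_of_inj hf]
  refine le_sigPos_of_posDef _ ?_
  rintro ⟨_, p, rfl⟩ hx
  have hp : p ≠ 0 := by
    rintro rfl
    exact hx (Subtype.ext (map_zero f))
  exact (hM'.prod hN') p hp

theorem signature_sum (A B : HermitianForm ℚ) :
    (A.sum B).signature = A.signature + B.signature := by
  have hpos := sigPos_add_le_prod A.quadraticForm B.quadraticForm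
  have hneg := sigPos_add_le_prod (-A.quadraticForm) (-B.quadraticForm)
  have he : QuadraticMap.prod (-A.quadraticForm) (-B.quadraticForm) =
      -QuadraticMap.prod A.quadraticForm B.quadraticForm := by
    ext p
    simp [add_comm]
  rw [he, sigPos_neg, sigPos_neg, sigPos_neg,
    (quadraticForm_sum_equivalent A B).sigNeg_eq] at hneg
  rw [(quadraticForm_sum_equivalent A B).sigPos_eq] at hpos
  have h1 := A.sigPos_add_sigNeg
  have h2 := B.sigPos_add_sigNeg
  have h3 := (A.sum B).sigPos_add_sigNeg
  have h4 : (A.sum B).dim = A.dim + B.dim := rfl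
  rw [signature, signature, signature]
  omega

theorem WittEquiv.signature_eq {A B : HermitianForm ℚ} (h : A.WittEquiv B) :
    A.signature = B.signature := by
  obtain ⟨M, N, hM, hN, h⟩ := h
  have := h.signature_eq
  rwa [signature_sum, signature_sum, hM.signature_eq_zero, hN.signature_eq_zero, add_zero,
    add_zero] at this

end HermitianForm

/-- The signature homomorphism on the Witt group of the rationals. -/
noncomputable def WittGroup.signature : WittGroup ℚ →+ ℤ where
  toFun := Quotient.lift HermitianForm.signature fun _ _ h =>
    HermitianForm.WittEquiv.signature_eq h
  map_zero' := HermitianForm.isMetabolic_zeroForm.signature_eq_zero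
  map_add' := by
    rintro ⟨A⟩ ⟨B⟩
    exact HermitianForm.signature_sum A B

theorem WittGroup.signature_mk (A : HermitianForm ℚ) :
    WittGroup.signature (WittGroup.mk A) = A.signature := rfl

/-!
The form `4⟨1⟩` is the norm form of Hamilton's quaternions over `ℚ`. Every positive rational `a`
is a sum of four rational squares, that is, the norm of a quaternion, and multiplication by this
quaternion is a similitude of factor `a`; hence `4⟨a⟩ ≅ 4⟨1⟩`
(`HermitianForm.isometric_diagonal_four`). Since every rational form is diagonalizable, `4w` is a
multiple of `4⟨1⟩` in the Witt group, and comparing signatures gives `4w = σ(w) • 4⟨1⟩`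
(`WittGroup.four_nsmul_eq`). The right-hand side is represented by the diagonal form with
`4|σ(w)|` entries equal to the sign of `σ(w)`, which bounds the Witt rank from above. The bound
from below is the inequality `|σ(A)| ≤ dim A` for the signature of a form.
-/

namespace HermitianForm

/-! ### Diagonal forms -/

/-- The diagonal form `⟨a₀, …, aₙ₋₁⟩` with nonzero rational entries. -/
def diagonal {n : ℕ} (a : Fin n → ℚˣ) : HermitianForm ℚ where
  dim := n
  matrix := Matrix.diagonal fun i => (a i : ℚ)
  isHermitian := Matrix.isHermitian_diagonal _
  isUnit_det := by
    rw [Matrix.det_diagonal]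
    exact isUnit_iff_ne_zero.2 (Finset.prod_ne_zero_iff.2 fun i _ => (a i).ne_zero)

theorem pairing_diagonal {n : ℕ} (a : Fin n → ℚˣ) (x y : Fin n → ℚ) :
    (diagonal a).pairing x y = ∑ i, (a i : ℚ) * (x i * y i) := by
  change dotProduct (star x) ((Matrix.diagonal fun i => (a i : ℚ)).mulVec y) = _
  simp only [dotProduct, Matrix.mulVec_diagonal, Pi.star_apply, star_trivial]
  exact Finset.sum_congr rfl fun i _ => by ring

theorem quadraticForm_diagonal {n : ℕ} (a : Fin n → ℚˣ) :
    (diagonal a).quadraticForm =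
      (QuadraticMap.weightedSumSquares ℚ a : QuadraticForm ℚ (Fin n → ℚ)) :=
  QuadraticMap.ext fun x => (quadraticForm_apply _ _).trans
    ((pairing_diagonal a x x).trans (QuadraticMap.weightedSumSquares_apply a x).symm)

theorem isometric_diagonal {m n : ℕ} {a : Fin m → ℚˣ} {b : Fin n → ℚˣ}
    (e : (Fin m → ℚ) ≃ₗ[ℚ] (Fin n → ℚ))
    (h : ∀ x y, ∑ i, (b i : ℚ) * (e x i * e y i) = ∑ i, (a i : ℚ) * (x i * y i)) :
    (diagonal a).Isometric (diagonal b) :=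
  ⟨e, fun x y => (pairing_diagonal b (e x) (e y)).trans
    ((h x y).trans (pairing_diagonal a x y).symm)⟩

/-- Over `ℚ` the quadratic form determines the pairing by polarization. -/
theorem isometric_of_equivalent {A B : HermitianForm ℚ}
    (h : A.quadraticForm.Equivalent B.quadraticForm) : A.Isometric B := by
  obtain ⟨e⟩ := h
  have he (x) : B.pairing (e.toLinearEquiv x) (e.toLinearEquiv x) = A.pairing x x := by
    rw [← quadraticForm_apply, ← quadraticForm_apply]
    exact e.map_app x
  refine ⟨e.toLinearEquiv, fun x y => ?_⟩
  have h1 := he (x + y)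
  rw [map_add, pairing_add_add, pairing_add_add, he, he,
    B.pairing_comm (e.toLinearEquiv y), A.pairing_comm y x] at h1
  linarith

theorem exists_isometric_diagonal (A : HermitianForm ℚ) :
    ∃ (n : ℕ) (a : Fin n → ℚˣ), A.Isometric (diagonal a) := by
  have hassoc (x y) : QuadraticMap.associated (R := ℚ) A.quadraticForm x y = A.pairing x y := by
    rw [QuadraticMap.associated_apply]
    simp only [quadraticForm_apply, pairing_add_add, A.pairing_comm y x]
    simp
    ring
  obtain ⟨a, ha⟩ := A.quadraticForm.equivalent_weightedSumSquares_units_of_nondegenerate'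
    fun x hx => A.eq_zero_of_pairing x fun y => by rw [A.pairing_comm, ← hassoc, hx]
  rw [← quadraticForm_diagonal] at ha
  exact ⟨_, a, isometric_of_equivalent ha⟩

theorem diagonal_isometric_sum {m n : ℕ} (a : Fin m → ℚˣ) (b : Fin n → ℚˣ) :
    (diagonal (Fin.append a b)).Isometric ((diagonal a).sum (diagonal b)) := by
  refine ⟨LinearEquiv.refl ℚ _, fun x y => ?_⟩
  rw [pairing_sum]
  erw [pairing_diagonal, pairing_diagonal, pairing_diagonal]
  rw [Fin.sum_univ_add]
  simp only [Fin.append_left, Fin.append_right]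
  rfl

/-! ### Four squares -/

theorem exists_four_squares_rat {a : ℚ} (ha : 0 ≤ a) :
    ∃ p q r s : ℚ, p ^ 2 + q ^ 2 + r ^ 2 + s ^ 2 = a := by
  -- `a = num / den = (num * den) / den ^ 2`
  obtain ⟨p, q, r, s, h⟩ := Nat.sum_four_squares (a.num.toNat * a.den)
  have hd : (a.den : ℚ) ≠ 0 := by exact_mod_cast a.den_ne_zero
  have hn : ((a.num.toNat : ℕ) : ℚ) = a * a.den := by
    rw [Rat.mul_den_eq_num]
    exact_mod_cast Int.toNat_of_nonneg (Rat.num_nonneg.2 ha)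
  have h' : (p ^ 2 + q ^ 2 + r ^ 2 + s ^ 2 : ℚ) = a * a.den * a.den := by
    rw [← hn]
    exact_mod_cast h
  refine ⟨p / a.den, q / a.den, r / a.den, s / a.den, ?_⟩
  field_simp
  linarith

/-- Multiplication by a quaternion of norm `a` is a similitude of factor `a` of the norm form. -/
theorem isometric_diagonal_four (a : ℚˣ) (ha : 0 < (a : ℚ)) :
    (diagonal fun _ : Fin 4 => a).Isometric (diagonal fun _ : Fin 4 => (1 : ℚˣ)) := by
  obtain ⟨p, q, r, s, h⟩ := exists_four_squares_rat ha.le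
  -- the matrix of left multiplication by `p + q i + r j + s k`
  let M : Matrix (Fin 4) (Fin 4) ℚ := !![p, -q, -r, -s; q, p, -s, r; r, s, p, -q; s, -r, q, p]
  have hM : M.transpose * M = (a : ℚ) • (1 : Matrix (Fin 4) (Fin 4) ℚ) := by
    ext i j
    fin_cases i <;> fin_cases j <;>
      simp [M, Matrix.mul_apply, Fin.sum_univ_four] <;> linarith
  have hinv : ((a : ℚ)⁻¹ • M.transpose) * M = 1 := by
    rw [Matrix.smul_mul, hM, smul_smul, inv_mul_cancel₀ ha.ne', one_smul]
  refine isometric_diagonal (Matrix.toLin'OfInv hinv (mul_eq_one_comm.1 hinv)) fun x y => ?_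
  have hdot : dotProduct (M.mulVec x) (M.mulVec y) = (a : ℚ) * dotProduct x y := by
    rw [dotProduct_comm, Matrix.dotProduct_mulVec, ← Matrix.mulVec_transpose,
      Matrix.mulVec_mulVec, hM, Matrix.smul_mulVec, Matrix.one_mulVec, smul_dotProduct,
      smul_eq_mul, dotProduct_comm]
  simp only [Matrix.toLin'OfInv_apply, Matrix.toLin'_apply, Units.val_one, one_mul,
    ← Finset.mul_sum]
  exact hdot

/-! ### The signature -/

theorem abs_signature_le_dim (A : HermitianForm ℚ) : |A.signature| ≤ A.dim := by
  have := A.sigPos_add_sigNeg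
  rw [signature, abs_le]
  omega

theorem signature_diagonal_one : (diagonal fun _ : Fin 1 => (1 : ℚˣ)).signature = 1 := by
  set A := diagonal fun _ : Fin 1 => (1 : ℚˣ)
  have h1 := A.sigPos_add_sigNeg
  have h2 : Module.finrank ℚ (⊤ : Submodule ℚ (Fin A.dim → ℚ)) ≤ sigPos A.quadraticForm := by
    refine le_sigPos_of_posDef _ fun x hx => ?_
    change 0 < A.quadraticForm (x : Fin A.dim → ℚ)
    rw [quadraticForm_apply]
    erw [pairing_diagonal]
    have hx0 : (x : Fin A.dim → ℚ) (0 : Fin 1) ≠ 0 := fun h0 => by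
      refine hx (Subtype.ext (funext fun i => ?_))
      obtain rfl : i = (0 : Fin 1) := Subsingleton.elim (α := Fin 1) i 0
      exact h0
    rw [Fin.sum_univ_one, Units.val_one, one_mul]
    exact mul_self_pos.2 hx0
  rw [finrank_top, Module.finrank_fin_fun] at h2
  have h3 : A.dim = 1 := rfl
  rw [signature]
  omega

end HermitianForm

namespace WittGroup

open HermitianForm

/-! ### Multiples of one-dimensional classes -/

/-- The Witt class `⟨a⟩` of the one-dimensional form with entry `a`. -/
def unary (a : ℚˣ) : WittGroup ℚ := mk (HermitianForm.diagonal fun _ : Fin 1 => a)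

theorem mk_diagonal {n : ℕ} (a : Fin n → ℚˣ) :
    mk (HermitianForm.diagonal a) = ∑ i, unary (a i) := by
  induction n with
  | zero =>
    refine mk_eq_of_isometric ⟨LinearEquiv.refl ℚ _, fun x y => ?_⟩
    rw [pairing_zeroForm]
    erw [pairing_diagonal]
    rfl
  | succ n ih =>
    have h : a = Fin.append (fun i => a i.castSucc) (fun _ : Fin 1 => a (Fin.last n)) := by
      rw [Fin.append_right_eq_snoc]
      exact (Fin.snoc_init_self a).symm
    rw [Fin.sum_univ_castSucc, ← ih fun i => a i.castSucc]
    conv_lhs => rw [h]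
    exact mk_eq_of_isometric (diagonal_isometric_sum _ _)

theorem mk_diagonal_const (n : ℕ) (a : ℚˣ) :
    mk (HermitianForm.diagonal fun _ : Fin n => a) = n • unary a := by
  rw [mk_diagonal, Finset.sum_const, Finset.card_univ, Fintype.card_fin]

theorem unary_neg (a : ℚˣ) : unary (-a) = -unary a := by
  refine mk_eq_of_isometric ⟨LinearEquiv.refl ℚ _, fun x y => ?_⟩
  refine (pairing_neg (HermitianForm.diagonal fun _ : Fin 1 => a) x y).trans ?_
  erw [pairing_diagonal, pairing_diagonal]
  simp

theorem signature_unary_one : signature (unary 1) = 1 := signature_diagonal_one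

theorem four_nsmul_unary_of_pos (a : ℚˣ) (ha : 0 < (a : ℚ)) : 4 • unary a = 4 • unary 1 := by
  rw [← mk_diagonal_const, ← mk_diagonal_const]
  exact mk_eq_of_isometric (isometric_diagonal_four a ha)

theorem exists_four_nsmul_unary_eq (a : ℚˣ) : ∃ k : ℤ, 4 • unary a = k • 4 • unary 1 := by
  rcases lt_or_gt_of_ne a.ne_zero with ha | ha
  · refine ⟨-1, ?_⟩
    have h := four_nsmul_unary_of_pos (-a) (by simpa using ha)
    rw [unary_neg, smul_neg] at h
    rw [neg_one_zsmul, ← h, neg_neg]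
  · exact ⟨1, by rw [one_zsmul, four_nsmul_unary_of_pos a ha]⟩

/-- Modulo metabolic forms, four copies of a form are determined by its signature. -/
theorem four_nsmul_eq (w : WittGroup ℚ) : 4 • w = signature w • 4 • unary 1 := by
  obtain ⟨A, rfl⟩ := Quotient.exists_rep w
  obtain ⟨n, a, hA⟩ := A.exists_isometric_diagonal
  choose k hk using exists_four_nsmul_unary_eq
  have hw : 4 • mk A = (∑ i, k (a i)) • 4 • unary 1 := by
    rw [mk_eq_of_isometric hA, mk_diagonal, Finset.smul_sum, Finset.sum_smul]
    exact Finset.sum_congr rfl fun i _ => hk (a i)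
  have hs := congrArg signature hw
  rw [map_nsmul, map_zsmul, map_nsmul, signature_unary_one] at hs
  have hk' : signature (mk A) = ∑ i, k (a i) := by
    simp only [nsmul_eq_mul, smul_eq_mul, Nat.cast_ofNat, mul_one] at hs
    linarith
  change 4 • mk A = signature (mk A) • 4 • unary 1
  rw [hk']
  exact hw

/-! ### The Witt rank -/

theorem rank_mk_le (A : HermitianForm ℚ) : (mk A).rank ≤ A.dim := Nat.sInf_le ⟨A, rfl, rfl⟩

theorem rank_nsmul_unary_le (n : ℕ) (a : ℚˣ) : (n • unary a).rank ≤ n := by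
  rw [← mk_diagonal_const]
  exact rank_mk_le _

theorem rank_zsmul_unary_one_le (k : ℤ) : ((k • unary 1).rank : ℤ) ≤ |k| := by
  rw [Int.abs_eq_natAbs, Nat.cast_le]
  obtain h | h := Int.natAbs_eq k
  · conv_lhs => rw [h, natCast_zsmul]
    exact rank_nsmul_unary_le _ _
  · conv_lhs => rw [h, neg_zsmul, natCast_zsmul, ← smul_neg, ← unary_neg]
    exact rank_nsmul_unary_le _ _

theorem abs_signature_le_rank (w : WittGroup ℚ) : |signature w| ≤ w.rank := by
  obtain ⟨A, rfl, hA⟩ := w.exists_dim_eq_rank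
  rw [← hA, signature_mk]
  exact A.abs_signature_le_dim

end WittGroup

theorem mainTheorem5 (w : WittGroup ℚ) :
    (((4 : ℕ) • w).rank : ℤ) = 4 * |WittGroup.signature w| := by
  have habs : |4 * WittGroup.signature w| = 4 * |WittGroup.signature w| := by
    rw [abs_mul]
    norm_num
  apply le_antisymm
  · have h : 4 • w = (4 * WittGroup.signature w) • WittGroup.unary 1 := by
      rw [WittGroup.four_nsmul_eq, mul_comm, mul_zsmul]
      rfl
    rw [h, ← habs]
    exact WittGroup.rank_zsmul_unary_one_le _
  · have h := WittGroup.abs_signature_le_rank ((4 : ℕ) • w)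
    rw [map_nsmul, nsmul_eq_mul, Nat.cast_ofNat, habs] at h
    exact h
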